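/- Let $H$ be a complex Hilbert space and let $T$ be a bounded linear operator on $H$ whose numerical range $W(T):=\{\langle Tx,x\rangle: x\in H,\ \|x\|=1\}$ is contained in the closed unit disk $\overline{\mathbb D}$. Let $f:\overline{\mathbb D}\to\overline{\mathbb D}$ be continuous on $\overline{\mathbb D}$ and holomorphic on the open unit disk $\mathbb D$, with Taylor series $f(z)=\sum_{n\ge0}a_nz^n$ on $\mathbb D$. Then, for every $0<r<1$, the series $f(rT):=\sum_{n\ge0}a_n r^nT^n$ converges unconditionally in operator norm, the limit $f(T):=\lim_{r\to1^-}f(rT)$ exists in operator norm, and $$w(f(T))\le 1+|f(0)|-|f(0)|^2\le \tfrac54,$$ where $w(S):=\sup\{|\langle Sx,x\rangle|: x\in H,\ \|x\|=1\}$ denotes the numerical radius of a bounded operator $S$ on $H$ (with $w(S):=0$ if $H=\{0\}$). -/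

import Mathlib

open Set Filter Topology Metric

noncomputable section

/-- The numerical range `W(T) = {⟨Tx, x⟩ : ‖x‖ = 1}`. Mathlib's inner product is linear in the
second variable, so the usual `⟨Tx, x⟩` is `inner ℂ x (T x)`. -/
def numericalRange {H : Type*} [NormedAddCommGroup H] [InnerProductSpace ℂ H]
    (T : H →L[ℂ] H) : Set ℂ :=
  {z : ℂ | ∃ x : H, ‖x‖ = 1 ∧ inner ℂ x (T x) = z}

/-- The numerical radius `w(T) = sup {|⟨Tx, x⟩| : ‖x‖ = 1}`. The set is bounded by `‖T‖`
(see `bddAbove_norm_numericalRange`); it is empty only for `H = 0`, where `w(T) = 0`. -/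
def numericalRadius {H : Type*} [NormedAddCommGroup H] [InnerProductSpace ℂ H]
    (T : H →L[ℂ] H) : ℝ :=
  sSup ((fun z : ℂ => ‖z‖) '' numericalRange T)

theorem bddAbove_norm_numericalRange {H : Type*} [NormedAddCommGroup H] [InnerProductSpace ℂ H]
    (T : H →L[ℂ] H) : BddAbove ((fun z : ℂ => ‖z‖) '' numericalRange T) := by
  refine ⟨‖T‖, ?_⟩
  rintro _ ⟨_, ⟨x, hx, rfl⟩, rfl⟩
  calc ‖inner ℂ x (T x)‖ ≤ ‖x‖ * ‖T x‖ := norm_inner_le_norm x (T x)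
    _ ≤ ‖x‖ * (‖T‖ * ‖x‖) := by gcongr; exact T.le_opNorm x
    _ = ‖T‖ := by rw [hx]; ring

/-- `f` belongs to the disk algebra: it is continuous on the closed unit disk and holomorphic on
the open unit disk. Values of `f` outside the closed disk play no role. -/
structure InDiskAlgebra (f : ℂ → ℂ) : Prop where
  continuousOn : ContinuousOn f (closedBall (0 : ℂ) 1)
  holomorphic : DifferentiableOn ℂ f (ball (0 : ℂ) 1)

/-- The `n`-th term `(f⁽ⁿ⁾(0) / n!) Aⁿ` of the Taylor series at `0` of `f`, evaluated at the
operator `A`. -/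
def taylorTerm {H : Type*} [NormedAddCommGroup H] [InnerProductSpace ℂ H]
    (f : ℂ → ℂ) (A : H →L[ℂ] H) (n : ℕ) : H →L[ℂ] H :=
  (iteratedDeriv n f 0 / (n.factorial : ℂ)) • A ^ n

/-- `f(A) = ∑ (f⁽ⁿ⁾(0) / n!) Aⁿ`, which is the holomorphic functional calculus when `f` is
holomorphic on the open unit disk and the spectrum of `A` lies in that disk. -/
def holoCalc {H : Type*} [NormedAddCommGroup H] [InnerProductSpace ℂ H]
    (f : ℂ → ℂ) (A : H →L[ℂ] H) : H →L[ℂ] H :=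
  ∑' n : ℕ, taylorTerm f A n

/-- `S` is `f(T)` in the sense of the disk-algebra calculus: for every `0 < r < 1` the Taylor
series of `f` converges unconditionally in operator norm at `rT`, so that `f(rT)` is defined, and
`f(rT) → S` in operator norm as `r → 1⁻`. -/
structure IsDiskCalc {H : Type*} [NormedAddCommGroup H] [InnerProductSpace ℂ H]
    (f : ℂ → ℂ) (T S : H →L[ℂ] H) : Prop where
  summable : ∀ r : ℝ, 0 < r → r < 1 → Summable (taylorTerm f ((r : ℂ) • T))
  tendsto : Tendsto (fun r : ℝ => holoCalc f ((r : ℂ) • T)) (𝓝[<] (1 : ℝ)) (𝓝 S)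

/-- `f(T) = lim_{r → 1⁻} f(rT)`, the limit being taken in operator norm. -/
def diskCalc {H : Type*} [NormedAddCommGroup H] [InnerProductSpace ℂ H]
    (f : ℂ → ℂ) (T : H →L[ℂ] H) : H →L[ℂ] H :=
  limUnder (𝓝[<] (1 : ℝ)) (fun r : ℝ => holoCalc f ((r : ℂ) • T))

end

/-! The hypothesis on `W(T)` makes `1 - zT` invertible with accretive inverse for `|z| < 1`.
Integrating a function `h` against the resulting positive kernel shows that `Re h ≥ m` on the disk
implies `Re ⟨h(rT)x, x⟩ ≥ (2m - Re h(0))‖x‖²` (`le_re_inner_holoCalc`). Everything about the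
calculus follows from this inequality.

Applied to unimodular multiples of `h`, it gives `‖h(rT)‖ ≤ 6 sup |h|`; with the uniform continuity
of `f`, this makes `f(rT)` Cauchy as `r → 1⁻`. Applied to `1/(1 - ug)` with `|u| = 1` and `g(0) =
0`, where `m = 1/2`, it gives the Berger–Stampfli bound `w(g(rT)) ≤ 1`.

For general `f`, put `α = f(0)` and let `A` be `(f - α)/(1 - ᾱf)` evaluated at `rT`. Then `w(A) ≤ 1`
and `f(rT)` is the Möbius image `(A + α)(1 + ᾱA)⁻¹`. For a unit vector `y`, the quadratic forms
involved depend only on `⟨Ay, y⟩` and `‖Ay‖²`, and these are tied by `‖Ay‖² ≤ 2 + 2√(1 - |⟨Ay,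
y⟩|²)` (`norm_sq_apply_le`). What remains is the real inequality `teardrop_support_le`. Scaling `f`
by `s < 1` and letting `s → 1`, then `r → 1`, finishes the proof. -/

section NumericalRadius

/-! ### Numerical radius estimates for a single operator. -/

variable {H : Type*} [NormedAddCommGroup H] [InnerProductSpace ℂ H]

theorem norm_inner_le_of_forall_unit {T : H →L[ℂ] H} {M : ℝ}
    (hT : ∀ x : H, ‖x‖ = 1 → ‖inner ℂ x (T x)‖ ≤ M) (x : H) :
    ‖inner ℂ x (T x)‖ ≤ M * ‖x‖ ^ 2 := by
  rcases eq_or_ne x 0 with rfl | hx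
  · simp
  have hn : ‖x‖ ≠ 0 := norm_ne_zero_iff.mpr hx
  have h := hT (((‖x‖⁻¹ : ℝ) : ℂ) • x) (by simp [norm_smul, hn])
  simp only [map_smul, inner_smul_left, inner_smul_right, norm_mul, Complex.conj_ofReal,
    Complex.norm_real, norm_inv, norm_norm] at h
  rw [← mul_assoc, ← sq, inv_pow, inv_mul_le_iff₀ (by positivity)] at h
  linarith

theorem re_inner_add_inner_le {A : H →L[ℂ] H} {M : ℝ}
    (hA : ∀ x, ‖inner ℂ x (A x)‖ ≤ M * ‖x‖ ^ 2) (x y : H) :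
    (inner ℂ y (A x)).re + (inner ℂ x (A y)).re ≤ M * (‖x‖ ^ 2 + ‖y‖ ^ 2) := by
  have h1 := (Complex.re_le_norm _).trans (hA (x + y))
  have h2 := (neg_le_abs _).trans ((Complex.abs_re_le_norm _).trans (hA (x - y)))
  simp only [map_add, map_sub, inner_add_left, inner_add_right, inner_sub_left, inner_sub_right,
    Complex.add_re, Complex.sub_re] at h1 h2
  linear_combination (h1 + h2) / 2 + M / 2 * parallelogram_law_with_norm ℂ x y

theorem norm_inner_smul_apply {A : H →L[ℂ] H} {u : ℂ} (hu : ‖u‖ = 1) (x : H) :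
    ‖inner ℂ x ((u • A) x)‖ = ‖inner ℂ x (A x)‖ := by
  simp [hu]

theorem opNorm_le_of_norm_inner_le {A : H →L[ℂ] H} {M : ℝ} (hM : 0 < M)
    (hA : ∀ x, ‖inner ℂ x (A x)‖ ≤ M * ‖x‖ ^ 2) : ‖A‖ ≤ 2 * M := by
  refine A.opNorm_le_bound (by positivity) fun x => ?_
  have key : ∀ y, (inner ℂ y (A x)).re ≤ M * (‖x‖ ^ 2 + ‖y‖ ^ 2) := fun y => by
    have h1 := re_inner_add_inner_le hA x y
    -- Replacing `A` by `-iA` and `x` by `ix` keeps `⟨y, Ax⟩` and flips the sign of the other term,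
    -- which therefore cancels in the sum.
    have h2 := re_inner_add_inner_le (A := (-Complex.I) • A)
      (fun x => (norm_inner_smul_apply (by simp) x).trans_le (hA x)) (Complex.I • x) y
    simp only [smul_apply, map_smul, inner_smul_left, inner_smul_right,
      norm_smul, Complex.norm_I, one_mul, ← mul_assoc] at h2
    simp at h2
    linarith
  -- `t = 1/(2M)` maximizes `t - Mt²`, hence gives the best bound from `y = t • A x`.
  have h := key (((1 / (2 * M) : ℝ) : ℂ) • A x)
  rw [inner_smul_left, Complex.conj_ofReal, Complex.re_ofReal_mul, inner_self_eq_norm_sq_to_K,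
    norm_smul, Complex.norm_real, Real.norm_of_nonneg (by positivity), mul_pow] at h
  have hre : (((‖A x‖ : ℝ) : ℂ) ^ 2).re = ‖A x‖ ^ 2 := by
    rw [← Complex.ofReal_pow, Complex.ofReal_re]
  erw [hre] at h
  have h4 : (1 / (2 * M)) * ‖A x‖ ^ 2 = 2 * M * (1 / (2 * M)) ^ 2 * ‖A x‖ ^ 2 := by
    field_simp
  have h5 : M * (1 / (2 * M)) ^ 2 * ‖A x‖ ^ 2 ≤ M * ‖x‖ ^ 2 := by linarith
  have h6 : M * (1 / (2 * M)) ^ 2 * ‖A x‖ ^ 2 = ‖A x‖ ^ 2 / (4 * M) := by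
    field_simp; ring
  rw [h6, div_le_iff₀ (by positivity)] at h5
  refine abs_le_of_sq_le_sq' ?_ (by positivity) |>.2
  linarith

section Adjoint

variable [CompleteSpace H]

theorem norm_apply_add_adjoint_apply_le {A : H →L[ℂ] H}
    (hA : ∀ x, ‖inner ℂ x (A x)‖ ≤ ‖x‖ ^ 2) (x : H) :
    ‖A x + A.adjoint x‖ ≤ 2 * ‖x‖ := by
  set y := A x + A.adjoint x with hy
  have h := re_inner_add_inner_le (M := 1) (by simpa using hA) x (((1 / 2 : ℝ) : ℂ) • y)
  have h1 : inner ℂ x (A (((1 / 2 : ℝ) : ℂ) • y))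
      = ((1 / 2 : ℝ) : ℂ) * inner ℂ (A.adjoint x) y := by
    rw [map_smul, inner_smul_right, ContinuousLinearMap.adjoint_inner_left]
  have h2 : (inner ℂ (A.adjoint x) y).re = (inner ℂ y (A.adjoint x)).re := by
    rw [← inner_conj_symm, Complex.conj_re]
  have h3 : (inner ℂ y (A x)).re + (inner ℂ y (A.adjoint x)).re = ‖y‖ ^ 2 := by
    rw [← Complex.add_re, ← inner_add_right, ← hy, inner_self_eq_norm_sq_to_K]
    norm_cast
  rw [h1, inner_smul_left, Complex.conj_ofReal, Complex.re_ofReal_mul, Complex.re_ofReal_mul, h2,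
    norm_smul, Complex.norm_real, Real.norm_of_nonneg (by positivity), mul_pow] at h
  refine abs_le_of_sq_le_sq' ?_ (by positivity) |>.2
  nlinarith

theorem norm_apply_sub_adjoint_apply_le {A : H →L[ℂ] H}
    (hA : ∀ x, ‖inner ℂ x (A x)‖ ≤ ‖x‖ ^ 2) (x : H) :
    ‖A x - A.adjoint x‖ ≤ 2 * ‖x‖ := by
  have h := norm_apply_add_adjoint_apply_le (A := Complex.I • A)
    (fun x => (norm_inner_smul_apply (by simp) x).trans_le (hA x)) x
  have : (Complex.I • A) x + (Complex.I • A).adjoint x = Complex.I • (A x - A.adjoint x) := by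
    simp [map_smulₛₗ, sub_eq_add_neg]
  rwa [this, norm_smul, Complex.norm_I, one_mul] at h

/-- A local refinement of `‖A‖ ≤ 2 w(A)`, in the case of a nonnegative inner product. -/
theorem norm_sq_apply_le_of_inner_eq_ofReal {A : H →L[ℂ] H}
    (hA : ∀ x, ‖inner ℂ x (A x)‖ ≤ ‖x‖ ^ 2) {x : H} (hx : ‖x‖ = 1) {r : ℝ}
    (hr : inner ℂ x (A x) = (r : ℂ)) : ‖A x‖ ^ 2 ≤ 2 + 2 * √(1 - r ^ 2) := by
  set p := A x
  set q := A.adjoint x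
  have hq : inner ℂ x q = (r : ℂ) := by
    rw [ContinuousLinearMap.adjoint_inner_right, ← inner_conj_symm, hr, Complex.conj_ofReal]
  have hsum : ‖p + q‖ ≤ 2 := by simpa [hx] using norm_apply_add_adjoint_apply_le hA x
  have hdiff : ‖p - q‖ ≤ 2 := by simpa [hx] using norm_apply_sub_adjoint_apply_le hA x
  have hr1 : r ^ 2 ≤ 1 := by
    have := hA x
    rw [hr, hx, Complex.norm_real, Real.norm_eq_abs] at this
    rw [← sq_abs]
    nlinarith [abs_nonneg r]
  have pyth : ∀ v : H, inner ℂ x v = (r : ℂ) → ‖v‖ ^ 2 = r ^ 2 + ‖v - (r : ℂ) • x‖ ^ 2 := by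
    intro v hv
    rw [@norm_sub_sq ℂ, inner_smul_right, ← inner_conj_symm, hv, norm_smul, hx]
    simp
    ring
  set b := ((1 / 2 : ℝ) : ℂ) • (p + q)
  have hb : ‖b‖ ≤ 1 := by
    rw [norm_smul, Complex.norm_real, Real.norm_of_nonneg (by positivity)]; linarith
  have hbx : inner ℂ x b = (r : ℂ) := by
    rw [inner_smul_right, inner_add_right, hr, hq]; push_cast; ring
  have hb2 : ‖b - (r : ℂ) • x‖ ≤ √(1 - r ^ 2) := by
    apply Real.le_sqrt_of_sq_le
    have := pyth b hbx
    nlinarith [norm_nonneg b]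
  have hc : ‖((1 / 2 : ℝ) : ℂ) • (p - q)‖ ≤ 1 := by
    rw [norm_smul, Complex.norm_real, Real.norm_of_nonneg (by positivity)]; linarith
  -- The self-adjoint part contributes at most `√(1 - r²)` orthogonally to `x` and the skew part at
  -- most `1`; then `r² + (1 + √(1 - r²))² = 2 + 2√(1 - r²)`.
  have hpb : p - (r : ℂ) • x = (b - (r : ℂ) • x) + ((1 / 2 : ℝ) : ℂ) • (p - q) := by
    simp only [b]; push_cast; module
  have h1 : ‖p - (r : ℂ) • x‖ ≤ √(1 - r ^ 2) + 1 := by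
    rw [hpb]; exact (norm_add_le _ _).trans (add_le_add hb2 hc)
  have h2 := pyth p hr
  have h3 := Real.sq_sqrt (show 0 ≤ 1 - r ^ 2 by linarith)
  nlinarith [norm_nonneg (p - (r : ℂ) • x), Real.sqrt_nonneg (1 - r ^ 2)]

theorem norm_sq_apply_le {A : H →L[ℂ] H} (hA : ∀ x, ‖inner ℂ x (A x)‖ ≤ ‖x‖ ^ 2) {x : H}
    (hx : ‖x‖ = 1) : ‖A x‖ ^ 2 ≤ 2 + 2 * √(1 - ‖inner ℂ x (A x)‖ ^ 2) := by
  obtain ⟨u, hu, hz⟩ := RCLike.exists_norm_eq_mul_self (inner ℂ x (A x))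
  have h := norm_sq_apply_le_of_inner_eq_ofReal (A := u • A)
    (fun x => (norm_inner_smul_apply hu x).trans_le (hA x)) hx
    (r := ‖inner ℂ x (A x)‖) (by simpa [inner_smul_right] using hz.symm)
  simpa [norm_smul, hu] using h

end Adjoint

/-! ### The teardrop inequality for Möbius images. -/

theorem sq_dot_le_of_sq_add_sq_add_sq_eq_one {l₁ l₂ l₃ p q w : ℝ}
    (h : p ^ 2 + q ^ 2 + w ^ 2 = 1) :
    (l₁ * p + l₂ * q + l₃ * w) ^ 2 ≤ l₁ ^ 2 + l₂ ^ 2 + l₃ ^ 2 := by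
  linear_combination (l₁ ^ 2 + l₂ ^ 2 + l₃ ^ 2) * h + sq_nonneg (l₁ * q - l₂ * p)
    + sq_nonneg (l₁ * w - l₃ * p) + sq_nonneg (l₂ * w - l₃ * q)

/-- Here `p + iq` stands for `⟨Ay, y⟩`, `m` for `‖Ay‖²`, and `(x, y)` for a direction in the plane.
The inequality is affine in `m`, with slope `a(x - ca)` for left side minus right side, so the sign
of `x - ca` decides which end of the range of `m` is the worst case. -/
theorem teardrop_support_le {a x y p q m : ℝ} (ha0 : 0 ≤ a) (ha1 : a ≤ 1)
    (hxy : x ^ 2 + y ^ 2 = 1) (hpq : p ^ 2 + q ^ 2 ≤ 1) (hm : p ^ 2 + q ^ 2 ≤ m)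
    (hm' : m ≤ 2 + 2 * √(1 - (p ^ 2 + q ^ 2))) :
    x * (a * (1 + m) + (1 + a ^ 2) * p) - y * ((1 - a ^ 2) * q)
      ≤ (1 + a - a ^ 2) * (1 + 2 * a * p + a ^ 2 * m) := by
  set c := 1 + a - a ^ 2 with hc
  have hx1 : x ≤ 1 := by nlinarith
  rcases le_total x (c * a) with hxa | hxa
  -- Worst case `m = |z|²` with `z = p + iq`: the scalar situation, where `|a + z| ≤ |1 + az|` gives
  -- the bound even with constant `1 ≤ c`.
  · set n := p ^ 2 + q ^ 2 with hn
    have hn0 : 0 ≤ n := by positivity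
    set D := 1 + 2 * a * p + a ^ 2 * n with hD
    have hD0 : 0 ≤ D := by
      have : D = (1 + a * p) ^ 2 + (a * q) ^ 2 := by rw [hD, hn]; ring
      rw [this]; positivity
    have hDD : (a + p) ^ 2 + q ^ 2 ≤ D := by
      have : D - ((a + p) ^ 2 + q ^ 2) = (1 - a ^ 2) * (1 - n) := by rw [hD, hn]; ring
      have : 0 ≤ (1 - a ^ 2) * (1 - n) := mul_nonneg (by nlinarith) (by linarith)
      linarith
    have hE : x * (a * (1 + n) + (1 + a ^ 2) * p) - y * ((1 - a ^ 2) * q) ≤ D := by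
      refine abs_le_of_sq_le_sq' ?_ hD0 |>.2
      have h1 : (x * (a * (1 + n) + (1 + a ^ 2) * p) - y * ((1 - a ^ 2) * q)) ^ 2
          + (x * ((1 - a ^ 2) * q) + y * (a * (1 + n) + (1 + a ^ 2) * p)) ^ 2
          = ((a + p) ^ 2 + q ^ 2) * D := by
        have : (x * (a * (1 + n) + (1 + a ^ 2) * p) - y * ((1 - a ^ 2) * q)) ^ 2
          + (x * ((1 - a ^ 2) * q) + y * (a * (1 + n) + (1 + a ^ 2) * p)) ^ 2
          = (x ^ 2 + y ^ 2) * ((a * (1 + n) + (1 + a ^ 2) * p) ^ 2 + ((1 - a ^ 2) * q) ^ 2) := by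
          ring
        rw [this, hxy, hD, hn]; ring
      nlinarith [mul_le_mul_of_nonneg_right hDD hD0,
        sq_nonneg (x * ((1 - a ^ 2) * q) + y * (a * (1 + n) + (1 + a ^ 2) * p))]
    have hc1 : 1 ≤ c := by rw [hc]; nlinarith
    have h2 : D ≤ c * D := by nlinarith
    have h3 : x * a * (m - n) ≤ c * a * a * (m - n) :=
      mul_le_mul_of_nonneg_right (mul_le_mul_of_nonneg_right hxa ha0) (by linarith)
    rw [hD] at h2 hE
    linear_combination hE + h2 + h3
  -- Worst case `m = 2 + 2w`: the claim becomes linear in the unit vector `(p, q, w)`, and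
  -- Cauchy–Schwarz reduces it to `|l| ≤ K`.
  · set w := √(1 - (p ^ 2 + q ^ 2)) with hw
    have hw2 : w ^ 2 = 1 - (p ^ 2 + q ^ 2) := Real.sq_sqrt (by linarith)
    have h3 : (x - c * a) * a * m ≤ (x - c * a) * a * (2 + 2 * w) :=
      mul_le_mul_of_nonneg_left hm' (mul_nonneg (by linarith) ha0)
    set l₁ := x * (1 + a ^ 2) - 2 * a * c with hl₁
    set l₂ := -(y * (1 - a ^ 2)) with hl₂
    set l₃ := 2 * a * (x - c * a) with hl₃
    set K := c * (1 + 2 * a ^ 2) - 3 * a * x with hK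
    have hK0 : 0 ≤ K := by
      have h : K = (1 - a) ^ 2 + 2 * a ^ 3 * (1 - a) + 3 * a * (1 - x) := by rw [hK, hc]; ring
      rw [h]
      have : 0 ≤ 2 * a ^ 3 * (1 - a) := mul_nonneg (by positivity) (by linarith)
      have : 0 ≤ 3 * a * (1 - x) := mul_nonneg (by positivity) (by linarith)
      positivity
    have hKl : l₁ ^ 2 + l₂ ^ 2 + l₃ ^ 2 ≤ K ^ 2 := by
      have h : K ^ 2 - (l₁ ^ 2 + l₂ ^ 2 + l₃ ^ 2) = (c - a * x) ^ 2 - (1 - a ^ 2) ^ 2 := by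
        have : l₂ ^ 2 = (1 - x ^ 2) * (1 - a ^ 2) ^ 2 := by
          rw [hl₂]; linear_combination (1 - a ^ 2) ^ 2 * hxy
        rw [this, hK, hl₁, hl₃]; ring
      -- The constant `c = 1 + a - a²` is what makes this an equality at `x = 1`.
      have h4 : 1 - a ^ 2 ≤ c - a * x := by
        rw [hc]; linear_combination mul_nonneg ha0 (sub_nonneg.mpr hx1)
      have h5 : 0 ≤ 1 - a ^ 2 := by nlinarith
      have h6 := pow_le_pow_left₀ h5 h4 2
      linarith
    have hCS : l₁ * p + l₂ * q + l₃ * w ≤ K :=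
      abs_le_of_sq_le_sq' ((sq_dot_le_of_sq_add_sq_add_sq_eq_one (by rw [hw2]; ring)).trans hKl)
        hK0 |>.2
    rw [hl₁, hl₂, hl₃, hK] at hCS
    linear_combination h3 + hCS

variable [CompleteSpace H]

theorem norm_inner_mobius_real_le {A : H →L[ℂ] H} (hA : ∀ x, ‖inner ℂ x (A x)‖ ≤ ‖x‖ ^ 2) {a : ℝ}
    (ha0 : 0 ≤ a) (ha1 : a ≤ 1) {y : H} (hy : ‖y‖ = 1) :
    ‖inner ℂ (y + (a : ℂ) • A y) ((a : ℂ) • y + A y)‖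
      ≤ (1 + a - a ^ 2) * ‖y + (a : ℂ) • A y‖ ^ 2 := by
  set z := inner ℂ y (A y) with hz
  set m := ‖A y‖ ^ 2 with hm
  have hyy : inner ℂ y y = (1 : ℂ) := by rw [inner_self_eq_norm_sq_to_K, hy]; simp
  have hvv : inner ℂ (A y) (A y) = (m : ℂ) := by rw [inner_self_eq_norm_sq_to_K, hm]; simp
  have hvy : inner ℂ (A y) y = starRingEnd ℂ z := by rw [hz, inner_conj_symm]
  have hN : inner ℂ (y + (a : ℂ) • A y) ((a : ℂ) • y + A y)
      = ((a * (1 + m) + (1 + a ^ 2) * z.re : ℝ) : ℂ)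
        + (((1 - a ^ 2) * z.im : ℝ) : ℂ) * Complex.I := by
    simp only [inner_add_left, inner_add_right, inner_smul_left, inner_smul_right, hyy, hvv, hvy,
      ← hz, Complex.conj_ofReal]
    apply Complex.ext <;> simp [sq] <;> ring
  have hD : ‖y + (a : ℂ) • A y‖ ^ 2 = 1 + 2 * a * z.re + a ^ 2 * m := by
    rw [@norm_add_sq ℂ, inner_smul_right, norm_smul, hy, ← hz]
    simp [hm, mul_pow]
    ring
  have hz2 : z.re ^ 2 + z.im ^ 2 = ‖z‖ ^ 2 := by
    rw [Complex.sq_norm, Complex.normSq_apply]; ring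
  have hz1 : ‖z‖ ≤ 1 := by simpa [hy] using hA y
  have hzm : ‖z‖ ^ 2 ≤ m := by
    have : ‖z‖ ≤ ‖A y‖ := by simpa [hy] using norm_inner_le_norm (𝕜 := ℂ) y (A y)
    rw [hm]; gcongr
  have hloc : m ≤ 2 + 2 * √(1 - ‖z‖ ^ 2) := norm_sq_apply_le hA hy
  rw [hD, hN]
  set s := a * (1 + m) + (1 + a ^ 2) * z.re
  set t := (1 - a ^ 2) * z.im with ht
  -- The modulus of `s + it` is recovered as the maximum over directions of these linear bounds.
  have key : ∀ x y' : ℝ, x ^ 2 + y' ^ 2 = 1 →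
      x * s - y' * t ≤ (1 + a - a ^ 2) * (1 + 2 * a * z.re + a ^ 2 * m) := fun x y' hxy =>
    teardrop_support_le ha0 ha1 hxy (by rw [hz2]; nlinarith [norm_nonneg z]) (by rwa [hz2])
      (by rwa [hz2])
  have hnorm := Complex.norm_add_mul_I s t
  rw [hnorm]
  rcases eq_or_lt_of_le (show 0 ≤ s ^ 2 + t ^ 2 by positivity) with h0 | h0
  · have hs : s = 0 := by nlinarith [sq_nonneg s, sq_nonneg t]
    have ht' : t = 0 := by nlinarith [sq_nonneg s, sq_nonneg t]
    rw [← h0, Real.sqrt_zero]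
    simpa [hs, ht'] using key 1 0 (by norm_num)
  · have hR := Real.sqrt_pos.mpr h0
    have hR2 := Real.sq_sqrt h0.le
    set R := √(s ^ 2 + t ^ 2)
    have := key (s / R) (-(t / R)) (by field_simp; linarith)
    have h' : s / R * s - -(t / R) * t = R := by field_simp; linarith
    rwa [h'] at this

theorem norm_inner_mobius_le {A : H →L[ℂ] H} (hA : ∀ x, ‖inner ℂ x (A x)‖ ≤ ‖x‖ ^ 2) {α : ℂ}
    (hα : ‖α‖ ≤ 1) (y : H) :
    ‖inner ℂ (y + starRingEnd ℂ α • A y) (α • y + A y)‖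
      ≤ (1 + ‖α‖ - ‖α‖ ^ 2) * ‖y + starRingEnd ℂ α • A y‖ ^ 2 := by
  obtain ⟨u, hu, hαu⟩ := RCLike.exists_norm_mul_eq_self α
  replace hαu : α = ‖α‖ * u := (mul_comm _ _).trans hαu |>.symm
  have huu : u * starRingEnd ℂ u = 1 := by
    rw [Complex.mul_conj, Complex.normSq_eq_norm_sq, hu]; simp
  rcases eq_or_ne y 0 with rfl | hy0
  · simp
  have hn : ‖y‖ ≠ 0 := norm_ne_zero_iff.mpr hy0
  have hnC : (‖y‖ : ℂ) ≠ 0 := by exact_mod_cast hn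
  set e : H := ((‖y‖⁻¹ : ℝ) : ℂ) • y with he
  have hye : y = (‖y‖ : ℂ) • e := by
    rw [he, smul_smul]; push_cast; rw [mul_inv_cancel₀ hnC, one_smul]
  -- Since `α = |α|u`, one has `ᾱA = |α|(ūA)` and `α + A = u(|α| + ūA)`, so rotating `A` makes the
  -- parameter real.
  have h := norm_inner_mobius_real_le (A := starRingEnd ℂ u • A)
    (fun x => (norm_inner_smul_apply (by simpa using hu) x).trans_le (hA x))
    (norm_nonneg α) hα (y := e) (by simp [he, norm_smul, hn])
  have h1 : y + starRingEnd ℂ α • A y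
      = (‖y‖ : ℂ) • (e + (‖α‖ : ℂ) • (starRingEnd ℂ u • A) e) := by
    conv_lhs => rw [hye, hαu]
    simp only [map_mul, Complex.conj_ofReal, map_smul, smul_apply]
    module
  have h2 : α • y + A y
      = ((‖y‖ : ℂ) * u) • ((‖α‖ : ℂ) • e + (starRingEnd ℂ u • A) e) := by
    conv_lhs => rw [hye]
    conv_lhs => enter [1, 1]; rw [hαu]
    simp only [map_smul, smul_apply, smul_add, smul_smul]
    rw [show (‖y‖ : ℂ) * u * starRingEnd ℂ u = ‖y‖ by rw [mul_assoc, huu, mul_one]]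
    congr 2
    ring
  rw [h1, h2, inner_smul_left, inner_smul_right, norm_smul, Complex.conj_ofReal, norm_mul, norm_mul,
    norm_mul, hu, Complex.norm_real, norm_norm, mul_pow]
  calc ‖y‖ * (‖y‖ * 1 * _) = ‖y‖ ^ 2 * _ := by ring
    _ ≤ ‖y‖ ^ 2 * _ := mul_le_mul_of_nonneg_left h (by positivity)
    _ = _ := by ring

end NumericalRadius

/-! ### Algebra of the Taylor-series functional calculus. -/

noncomputable section TaylorCalculus

/-- Uniqueness of power series; through `taylorCoeff_eq` it identifies the coefficients of sums,
products and dilations without differentiating. -/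
theorem eq_of_hasSum_mul_pow {a b : ℕ → ℂ} {f : ℂ → ℂ}
    (ha : ∀ z ∈ ball (0 : ℂ) 1, HasSum (fun n => a n * z ^ n) (f z))
    (hb : ∀ z ∈ ball (0 : ℂ) 1, HasSum (fun n => b n * z ^ n) (f z)) : a = b := by
  have key : ∀ c : ℕ → ℂ, (∀ z ∈ ball (0 : ℂ) 1, HasSum (fun n => c n * z ^ n) (f z)) →
      HasFPowerSeriesOnBall f (FormalMultilinearSeries.ofScalars ℂ c) 0 1 := by
    intro c hc
    refine ⟨?_, one_pos, ?_⟩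
    · refine ENNReal.le_of_forall_nnreal_lt fun r hr => ?_
      have hr1 : (r : ℝ) < 1 := by exact_mod_cast hr
      have hs := (hc (r : ℝ) (by simpa using hr1)).summable.norm
      refine FormalMultilinearSeries.le_radius_of_summable _ ?_
      refine hs.congr fun n => ?_
      rw [FormalMultilinearSeries.ofScalars_norm]
      simp
    · intro y hy
      have hy1 : y ∈ ball (0 : ℂ) 1 := by
        have := hy
        rw [← ENNReal.ofReal_one, Metric.eball_ofReal] at this
        exact this
      simpa [mul_comm] using hc y hy1
  have h := (key a ha).hasFPowerSeriesAt.eq_formalMultilinearSeries (key b hb).hasFPowerSeriesAt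
  exact FormalMultilinearSeries.ofScalars_series_injective ℂ ℂ h

/-- The Taylor coefficients at `0`. -/
def taylorCoeff (f : ℂ → ℂ) (n : ℕ) : ℂ := iteratedDeriv n f 0 / (n.factorial : ℂ)

theorem hasSum_taylorCoeff {f : ℂ → ℂ} (hf : DifferentiableOn ℂ f (ball 0 1)) {z : ℂ}
    (hz : z ∈ ball (0 : ℂ) 1) : HasSum (fun n => taylorCoeff f n * z ^ n) (f z) := by
  convert! Complex.hasSum_taylorSeries_on_ball hf hz using 2 with n
  simp [taylorCoeff, div_eq_mul_inv]
  ring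

theorem taylorCoeff_eq {f : ℂ → ℂ} (hf : DifferentiableOn ℂ f (ball 0 1)) {b : ℕ → ℂ}
    (hb : ∀ z ∈ ball (0 : ℂ) 1, HasSum (fun n => b n * z ^ n) (f z)) : taylorCoeff f = b :=
  eq_of_hasSum_mul_pow (fun _ hz => hasSum_taylorCoeff hf hz) hb

theorem taylorCoeff_zero (f : ℂ → ℂ) : taylorCoeff f 0 = f 0 := by
  simp [taylorCoeff]

theorem summable_norm_taylorCoeff {f : ℂ → ℂ} (hf : DifferentiableOn ℂ f (ball 0 1)) {s : ℝ}
    (hs0 : 0 ≤ s) (hs1 : s < 1) : Summable fun n => ‖taylorCoeff f n‖ * s ^ n := by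
  have := (hasSum_taylorCoeff hf (z := (s : ℂ))
    (by simpa [abs_of_nonneg hs0] using hs1)).summable.norm
  simpa [abs_of_nonneg hs0] using this

theorem taylorCoeff_add {f g : ℂ → ℂ} (hf : DifferentiableOn ℂ f (ball 0 1))
    (hg : DifferentiableOn ℂ g (ball 0 1)) :
    taylorCoeff (fun z => f z + g z) = fun n => taylorCoeff f n + taylorCoeff g n :=
  taylorCoeff_eq (hf.add hg) fun z hz => by
    simpa [add_mul] using (hasSum_taylorCoeff hf hz).add (hasSum_taylorCoeff hg hz)

theorem taylorCoeff_const (k : ℂ) : taylorCoeff (fun _ => k) = Pi.single 0 k :=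
  taylorCoeff_eq (differentiableOn_const k) fun z _ => by
    convert hasSum_single (f := fun n => (Pi.single 0 k : ℕ → ℂ) n * z ^ n) 0 ?_ using 1
    · simp
    · intro n hn; simp [hn]

theorem taylorCoeff_comp_mul {f : ℂ → ℂ} (hf : DifferentiableOn ℂ f (ball 0 1)) {c : ℂ}
    (hc : ‖c‖ ≤ 1) : taylorCoeff (fun z => f (c * z)) = fun n => c ^ n * taylorCoeff f n := by
  have hmem : ∀ z ∈ ball (0 : ℂ) 1, c * z ∈ ball (0 : ℂ) 1 := fun z hz => by
    rw [mem_ball_zero_iff] at hz ⊢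
    rw [norm_mul]
    nlinarith [norm_nonneg c, norm_nonneg z]
  refine taylorCoeff_eq (hf.comp (differentiableOn_id.const_mul c) hmem) fun z hz => ?_
  have e : (fun n => c ^ n * taylorCoeff f n * z ^ n) = fun n => taylorCoeff f n * (c * z) ^ n := by
    ext n; rw [mul_pow]; ring
  rw [e]
  exact hasSum_taylorCoeff hf (hmem z hz)

theorem taylorCoeff_mul {f g : ℂ → ℂ} (hf : DifferentiableOn ℂ f (ball 0 1))
    (hg : DifferentiableOn ℂ g (ball 0 1)) :
    taylorCoeff (fun z => f z * g z) =
      fun n => ∑ kl ∈ Finset.HasAntidiagonal.antidiagonal n, taylorCoeff f kl.1 * taylorCoeff g kl.2 := by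
  refine taylorCoeff_eq (hf.mul hg) fun z hz => ?_
  have h1 := hasSum_taylorCoeff hf hz
  have h2 := hasSum_taylorCoeff hg hz
  have h3 := (summable_norm_sum_mul_antidiagonal_of_summable_norm h1.summable.norm
    h2.summable.norm).of_norm.hasSum
  rw [← tsum_mul_tsum_eq_tsum_sum_antidiagonal_of_summable_norm h1.summable.norm
    h2.summable.norm, h1.tsum_eq, h2.tsum_eq] at h3
  change HasSum _ (f z * g z)
  convert! h3 using 2 with n
  rw [Finset.sum_mul]
  refine Finset.sum_congr rfl fun kl hkl => ?_
  rw [← Finset.HasAntidiagonal.mem_antidiagonal.mp hkl, pow_add]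
  ring

variable {H : Type*} [NormedAddCommGroup H] [InnerProductSpace ℂ H]

/-- The norms of the powers of `A` decay geometrically. -/
def HasPowerDecay (A : H →L[ℂ] H) : Prop :=
  ∃ ρ C : ℝ, 0 ≤ ρ ∧ ρ < 1 ∧ ∀ n, ‖A ^ n‖ ≤ C * ρ ^ n

theorem taylorTerm_eq (f : ℂ → ℂ) (A : H →L[ℂ] H) (n : ℕ) :
    taylorTerm f A n = taylorCoeff f n • A ^ n := rfl

theorem summable_norm_taylorTerm {f : ℂ → ℂ} (hf : DifferentiableOn ℂ f (ball 0 1))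
    {A : H →L[ℂ] H} (hA : HasPowerDecay A) : Summable fun n => ‖taylorTerm f A n‖ := by
  obtain ⟨ρ, C, h0, h1, h⟩ := hA
  refine Summable.of_nonneg_of_le (fun _ => norm_nonneg _) (fun n => ?_)
    ((summable_norm_taylorCoeff hf h0 h1).mul_left C)
  rw [taylorTerm_eq, norm_smul]
  calc ‖taylorCoeff f n‖ * ‖A ^ n‖ ≤ ‖taylorCoeff f n‖ * (C * ρ ^ n) := by gcongr; exact h n
    _ = _ := by ring

theorem holoCalc_const (k : ℂ) (A : H →L[ℂ] H) : holoCalc (fun _ => k) A = k • 1 := by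
  unfold holoCalc
  rw [tsum_eq_single 0]
  · simp [taylorTerm_eq, taylorCoeff_const]
  · intro n hn
    simp [taylorTerm_eq, taylorCoeff_const, hn]

theorem holoCalc_congr {f g : ℂ → ℂ} (hf : DifferentiableOn ℂ f (ball 0 1))
    (hg : DifferentiableOn ℂ g (ball 0 1)) (h : EqOn f g (ball 0 1)) (A : H →L[ℂ] H) :
    holoCalc f A = holoCalc g A := by
  have : taylorCoeff f = taylorCoeff g :=
    taylorCoeff_eq hf fun z hz => h hz ▸ hasSum_taylorCoeff hg hz
  unfold holoCalc
  congr 1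
  ext1 n
  rw [taylorTerm_eq, taylorTerm_eq, this]

theorem holoCalc_comp_mul {f : ℂ → ℂ} (hf : DifferentiableOn ℂ f (ball 0 1)) {c : ℂ}
    (hc : ‖c‖ ≤ 1) (A : H →L[ℂ] H) : holoCalc (fun z => f (c * z)) A = holoCalc f (c • A) := by
  unfold holoCalc
  congr 1
  ext1 n
  rw [taylorTerm_eq, taylorTerm_eq, taylorCoeff_comp_mul hf hc, smul_pow, smul_smul, mul_comm]

variable [CompleteSpace H]

theorem holoCalc_add {f g : ℂ → ℂ} (hf : DifferentiableOn ℂ f (ball 0 1))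
    (hg : DifferentiableOn ℂ g (ball 0 1)) {A : H →L[ℂ] H} (hA : HasPowerDecay A) :
    holoCalc (fun z => f z + g z) A = holoCalc f A + holoCalc g A := by
  unfold holoCalc
  rw [← (summable_norm_taylorTerm hf hA).of_norm.tsum_add (summable_norm_taylorTerm hg hA).of_norm]
  congr 1
  ext1 n
  rw [taylorTerm_eq, taylorTerm_eq, taylorTerm_eq, taylorCoeff_add hf hg, add_smul]

theorem holoCalc_mul {f g : ℂ → ℂ} (hf : DifferentiableOn ℂ f (ball 0 1))
    (hg : DifferentiableOn ℂ g (ball 0 1)) {A : H →L[ℂ] H} (hA : HasPowerDecay A) :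
    holoCalc (fun z => f z * g z) A = holoCalc f A * holoCalc g A := by
  unfold holoCalc
  rw [tsum_mul_tsum_eq_tsum_sum_antidiagonal_of_summable_norm (summable_norm_taylorTerm hf hA)
    (summable_norm_taylorTerm hg hA)]
  congr 1
  ext1 n
  rw [taylorTerm_eq, taylorCoeff_mul hf hg, Finset.sum_smul]
  refine Finset.sum_congr rfl fun kl hkl => ?_
  rw [taylorTerm_eq, taylorTerm_eq, smul_mul_smul_comm, ← pow_add, Finset.HasAntidiagonal.mem_antidiagonal.mp hkl]

theorem holoCalc_const_mul {f : ℂ → ℂ} (hf : DifferentiableOn ℂ f (ball 0 1)) (k : ℂ)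
    {A : H →L[ℂ] H} (hA : HasPowerDecay A) :
    holoCalc (fun z => k * f z) A = k • holoCalc f A := by
  rw [holoCalc_mul (differentiableOn_const k) hf hA, holoCalc_const, smul_one_mul]

end TaylorCalculus

/-! ### Fourier integrals and a positive-kernel bound for Hadamard products. -/

section Poisson

open MeasureTheory intervalIntegral

theorem norm_exp_int_mul_mul_I (k : ℤ) (θ : ℝ) : ‖Complex.exp (k * θ * Complex.I)‖ = 1 := by
  have := Complex.norm_exp_ofReal_mul_I (k * θ)
  push_cast at this
  exact this

theorem integral_exp_int_mul_mul_I (k : ℤ) :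
    ∫ θ in (0 : ℝ)..(2 * Real.pi), Complex.exp (k * θ * Complex.I)
      = if k = 0 then (2 * Real.pi : ℂ) else 0 := by
  split_ifs with h
  · simp [h]
  · have hk : (k * Complex.I : ℂ) ≠ 0 := by simp [h]
    have := integral_exp_mul_complex (a := 0) (b := 2 * Real.pi) hk
    have h2 : Complex.exp (k * Complex.I * ((2 * Real.pi : ℝ) : ℂ)) = 1 :=
      Complex.exp_eq_one_iff.mpr ⟨k, by push_cast; ring⟩
    rw [h2] at this
    simp only [Complex.ofReal_zero, mul_zero, Complex.exp_zero, sub_self, zero_div] at this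
    rw [← this]
    congr 1
    ext θ
    ring_nf

variable {ι : Type*}

theorem continuous_tsum_mul_exp {w : ι → ℂ} (hw : Summable fun i => ‖w i‖) (k : ι → ℤ) :
    Continuous fun θ : ℝ => ∑' i, w i * Complex.exp (k i * θ * Complex.I) :=
  continuous_tsum (fun i => by fun_prop) hw fun i θ => by
    rw [norm_mul, norm_exp_int_mul_mul_I, mul_one]

theorem integral_tsum_mul_exp [Countable ι] {w : ι → ℂ} (hw : Summable fun i => ‖w i‖)
    (k : ι → ℤ) :
    ∫ θ in (0 : ℝ)..(2 * Real.pi), ∑' i, w i * Complex.exp (k i * θ * Complex.I)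
      = 2 * Real.pi * ∑' i, if k i = 0 then w i else 0 := by
  have h := intervalIntegral.hasSum_integral_of_dominated_convergence (μ := volume)
    (a := 0) (b := 2 * Real.pi)
    (F := fun i (θ : ℝ) => w i * Complex.exp (k i * θ * Complex.I))
    (f := fun θ : ℝ => ∑' i, w i * Complex.exp (k i * θ * Complex.I))
    (fun i _ => ‖w i‖)
    (fun i => Continuous.aestronglyMeasurable (by fun_prop))
    (fun i => .of_forall fun θ _ => by rw [norm_mul, norm_exp_int_mul_mul_I, mul_one])
    (.of_forall fun θ _ => hw) intervalIntegrable_const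
    (.of_forall fun θ _ => (Summable.of_norm (by
      simpa [norm_exp_int_mul_mul_I] using hw)).hasSum)
  rw [← h.tsum_eq, ← tsum_mul_left]
  congr 1
  ext1 i
  rw [intervalIntegral.integral_const_mul, integral_exp_int_mul_mul_I]
  split_ifs <;> ring

theorem tsum_mul_exp_mul_tsum_mul_exp {κ : Type*} {v : ι → ℂ} {w : κ → ℂ}
    (hv : Summable fun i => ‖v i‖) (hw : Summable fun i => ‖w i‖) (k : ι → ℤ) (l : κ → ℤ) (θ : ℝ) :
    (∑' i, v i * Complex.exp (k i * θ * Complex.I)) *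
        ∑' j, w j * Complex.exp (l j * θ * Complex.I)
      = ∑' p : ι × κ, v p.1 * w p.2 *
          Complex.exp ((k p.1 + l p.2 : ℤ) * θ * Complex.I) := by
  rw [tsum_mul_tsum_of_summable_norm]
  · congr 1
    ext1 p
    push_cast
    rw [add_mul, add_mul, Complex.exp_add]
    ring
  · simpa [norm_exp_int_mul_mul_I] using hv
  · simpa [norm_exp_int_mul_mul_I] using hw

theorem tsum_ite_cast_add_neg_cast_eq_zero (v w : ℕ → ℂ) :
    (∑' p : ℕ × ℕ, if ((p.1 : ℤ) + -(p.2 : ℤ)) = 0 then v p.1 * w p.2 else 0)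
      = ∑' n, v n * w n := by
  have hinj : Function.Injective fun n : ℕ => (n, n) := fun a b h => (Prod.ext_iff.mp h).1
  rw [← hinj.tsum_eq]
  · simp
  · rintro ⟨a, b⟩ h
    simp only [Function.mem_support, ne_eq, ite_eq_right_iff, not_forall] at h
    obtain ⟨h, -⟩ := h
    exact ⟨a, by ext <;> simp; omega⟩

theorem tsum_ite_cast_add_cast_eq_zero (v w : ℕ → ℂ) :
    (∑' p : ℕ × ℕ, if ((p.1 : ℤ) + (p.2 : ℤ)) = 0 then v p.1 * w p.2 else 0) = v 0 * w 0 := by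
  rw [tsum_eq_single (0, 0)]
  · simp
  · rintro ⟨a, b⟩ h
    rw [if_neg]
    intro h'
    apply h
    ext <;> simp <;> omega

/-- If `φ = ∑ cₙ zⁿ` has nonnegative real part on the circle of radius `ρ`, with `φ(0)` real, and
`h = ∑ aₙ zⁿ` has real part at least `m` there, then the Hadamard product of the two series is
bounded below at `ρ²`. -/
theorem le_re_tsum_hadamard {a c : ℕ → ℂ} {ρ m : ℝ} (hρ : 0 ≤ ρ)
    (ha : Summable fun n => ‖a n‖ * ρ ^ n) (hc : Summable fun n => ‖c n‖ * ρ ^ n)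
    (hc0 : (c 0).im = 0) (hφ : ∀ z : ℂ, ‖z‖ = ρ → 0 ≤ (∑' n, c n * z ^ n).re)
    (hh : ∀ z : ℂ, ‖z‖ = ρ → m ≤ (∑' n, a n * z ^ n).re) :
    (2 * m - (a 0).re) * (c 0).re ≤ (∑' n, a n * ρ ^ n * (c n * ρ ^ n)).re := by
  set v : ℕ → ℂ := fun n => a n * ρ ^ n with hv
  set w : ℕ → ℂ := fun n => c n * ρ ^ n with hw
  have hvs : Summable fun n => ‖v n‖ := by simpa [hv, abs_of_nonneg hρ] using ha
  have hws : Summable fun n => ‖w n‖ := by simpa [hw, abs_of_nonneg hρ] using hc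
  have hws' : Summable fun n => ‖starRingEnd ℂ (w n)‖ := by simpa using hws
  set F : ℝ → ℂ := fun θ => ∑' n : ℕ, v n * Complex.exp (((n : ℤ) : ℂ) * θ * Complex.I) with hF
  -- Negative frequencies make the mean of `F Φ` the Hadamard sum, while the mean of `F Φ̄` keeps
  -- only the constant terms. The kernel `Φ + Φ̄ = 2 Re Φ` is nonnegative with mean `2 Re c₀`,
  -- whence the factor `2m`.
  set Φ : ℝ → ℂ := fun θ => ∑' n : ℕ, w n * Complex.exp (((-(n : ℤ) : ℤ) : ℂ) * θ * Complex.I)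
    with hΦ
  set Ψ : ℝ → ℂ := fun θ =>
    ∑' n : ℕ, starRingEnd ℂ (w n) * Complex.exp (((n : ℤ) : ℂ) * θ * Complex.I) with hΨ
  have hΨΦ : ∀ θ, Ψ θ = starRingEnd ℂ (Φ θ) := by
    intro θ
    rw [hΦ, hΨ, Complex.conj_tsum]
    refine tsum_congr fun n => ?_
    rw [map_mul (starRingEnd ℂ) (w n), ← Complex.exp_conj]
    congr 2
    simp
  have hcF : Continuous F := continuous_tsum_mul_exp hvs _
  have hcΦ : Continuous Φ := continuous_tsum_mul_exp hws _
  have hcΨ : Continuous Ψ := continuous_tsum_mul_exp hws' _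
  have hFre : ∀ θ, m ≤ (F θ).re := by
    intro θ
    convert hh (ρ * Complex.exp (θ * Complex.I)) ?_ using 2
    · refine tsum_congr fun n => ?_
      rw [mul_pow, ← Complex.exp_nat_mul, hv]
      push_cast
      ring_nf
    · rw [norm_mul, Complex.norm_exp_ofReal_mul_I, Complex.norm_real, Real.norm_of_nonneg hρ,
        mul_one]
  have hΦre : ∀ θ, 0 ≤ (Φ θ).re := by
    intro θ
    convert hφ (ρ * Complex.exp ((-θ : ℝ) * Complex.I)) ?_ using 2
    · refine tsum_congr fun n => ?_
      rw [mul_pow, ← Complex.exp_nat_mul, hw]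
      push_cast
      ring_nf
    · rw [norm_mul, Complex.norm_exp_ofReal_mul_I, Complex.norm_real, Real.norm_of_nonneg hρ,
        mul_one]
  have hI1 : ∫ θ in (0 : ℝ)..(2 * Real.pi), F θ * Φ θ = 2 * Real.pi * ∑' n, v n * w n := by
    rw [← tsum_ite_cast_add_neg_cast_eq_zero v w]
    rw [← integral_tsum_mul_exp (ι := ℕ × ℕ) (summable_mul_of_summable_norm hvs hws).norm]
    congr 1
    ext1 θ
    exact tsum_mul_exp_mul_tsum_mul_exp hvs hws _ _ θ
  have hI2 : ∫ θ in (0 : ℝ)..(2 * Real.pi), F θ * Ψ θ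
      = 2 * Real.pi * (v 0 * starRingEnd ℂ (w 0)) := by
    rw [← tsum_ite_cast_add_cast_eq_zero v fun n => starRingEnd ℂ (w n)]
    rw [← integral_tsum_mul_exp (ι := ℕ × ℕ) (summable_mul_of_summable_norm hvs hws').norm]
    congr 1
    ext1 θ
    exact tsum_mul_exp_mul_tsum_mul_exp hvs hws' _ _ θ
  have hI3 : ∫ θ in (0 : ℝ)..(2 * Real.pi), Φ θ = 2 * Real.pi * w 0 := by
    rw [hΦ, integral_tsum_mul_exp hws, tsum_eq_single 0]
    · simp
    · intro n hn; simp [hn]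
  have hre : ∀ G : ℝ → ℂ, Continuous G →
      ∫ θ in (0 : ℝ)..(2 * Real.pi), (G θ).re = (∫ θ in (0 : ℝ)..(2 * Real.pi), G θ).re :=
    fun G hG => Complex.reCLM.intervalIntegral_comp_comm (hG.intervalIntegrable _ _)
  have hmono : ∫ θ in (0 : ℝ)..(2 * Real.pi), 2 * m * (Φ θ).re
      ≤ ∫ θ in (0 : ℝ)..(2 * Real.pi), (F θ * Φ θ + F θ * Ψ θ).re := by
    refine intervalIntegral.integral_mono_on (by positivity)
      (Continuous.intervalIntegrable (by fun_prop) _ _)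
      (Continuous.intervalIntegrable (by fun_prop) _ _) fun θ _ => ?_
    rw [hΨΦ, ← mul_add, Complex.add_conj, Complex.re_mul_ofReal]
    nlinarith [hFre θ, hΦre θ]
  have hadd : ∫ θ in (0 : ℝ)..(2 * Real.pi), (F θ * Φ θ + F θ * Ψ θ)
      = (∫ θ in (0 : ℝ)..(2 * Real.pi), F θ * Φ θ) + ∫ θ in (0 : ℝ)..(2 * Real.pi), F θ * Ψ θ :=
    intervalIntegral.integral_add ((hcF.mul hcΦ).intervalIntegrable _ _)
      ((hcF.mul hcΨ).intervalIntegrable _ _)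
  rw [intervalIntegral.integral_const_mul, hre _ hcΦ, hre _ (by fun_prop),
hadd, hI1, hI2, hI3, ← mul_add] at hmono
  have hpi : (2 * Real.pi : ℂ) = ((2 * Real.pi : ℝ) : ℂ) := by push_cast; ring
  rw [hpi, Complex.re_ofReal_mul, Complex.re_ofReal_mul, Complex.add_re] at hmono
  have hv0 : v 0 = a 0 := by simp [hv]
  have hw0 : w 0 = c 0 := by simp [hw]
  rw [hv0, hw0, Complex.mul_re, Complex.conj_re, Complex.conj_im, hc0] at hmono
  have := Real.two_pi_pos
  have h2 : 2 * m * (c 0).re ≤ (∑' n, v n * w n).re + ((a 0).re * (c 0).re - (a 0).im * -0) := by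
    refine le_of_mul_le_mul_left ?_ this
    linarith
  linarith

end Poisson

/-! ### Resolvent positivity, norm bounds and existence of the limit. -/

section Calculus

variable {H : Type*} [NormedAddCommGroup H] [InnerProductSpace ℂ H]

theorem le_re_inner_one_sub_smul {T : H →L[ℂ] H} (hT : ∀ x, ‖inner ℂ x (T x)‖ ≤ ‖x‖ ^ 2) (z : ℂ)
    (x : H) : (1 - ‖z‖) * ‖x‖ ^ 2 ≤ (inner ℂ x ((1 - z • T) x)).re := by
  have h1 : inner ℂ x ((1 - z • T) x) = ((‖x‖ ^ 2 : ℝ) : ℂ) - z * inner ℂ x (T x) := by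
    simp [inner_self_eq_norm_sq_to_K]
  have h2 : (z * inner ℂ x (T x)).re ≤ ‖z‖ * ‖x‖ ^ 2 :=
    (Complex.re_le_norm _).trans (by rw [norm_mul]; gcongr; exact hT x)
  rw [h1, Complex.sub_re, Complex.ofReal_re]
  linarith

variable [CompleteSpace H]

theorem isUnit_one_sub_smul_of_norm_lt_one {T : H →L[ℂ] H}
    (hT : ∀ x, ‖inner ℂ x (T x)‖ ≤ ‖x‖ ^ 2) {z : ℂ} (hz : ‖z‖ < 1) : IsUnit (1 - z • T) := by
  refine ContinuousLinearMap.isUnit_of_forall_le_norm_inner_map _ (c := ⟨1 - ‖z‖, by linarith⟩)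
    (NNReal.coe_pos.mp (sub_pos.mpr hz)) fun x => ?_
  rw [norm_inner_symm]
  refine le_trans ?_ (Complex.re_le_norm _)
  rw [mul_comm]
  exact le_re_inner_one_sub_smul hT z x

/-- The Neumann series is known near `0`; holomorphy of the resolvent on the larger disk extends its
convergence there, although `‖T‖` may exceed `1`. -/
theorem hasFPowerSeriesOnBall_inverse_one_sub_smul_of_lt_one {T : H →L[ℂ] H}
    (hT : ∀ x, ‖inner ℂ x (T x)‖ ≤ ‖x‖ ^ 2) {r : NNReal} (hr0 : 0 < r) (hr1 : r < 1) :
    HasFPowerSeriesOnBall (fun z : ℂ => Ring.inverse (1 - z • T))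
      (fun n => ContinuousMultilinearMap.mkPiRing ℂ (Fin n) (T ^ n)) 0 r := by
  have hd : DifferentiableOn ℂ (fun z : ℂ => Ring.inverse (1 - z • T)) (closedBall 0 r) := by
    intro z hz
    have hz1 : ‖z‖ < 1 := (mem_closedBall_zero_iff.mp hz).trans_lt (by exact_mod_cast hr1)
    have h : Differentiable ℂ fun w : ℂ => 1 - w • T :=
      (differentiable_id.smul_const T).const_sub 1
    exact (DifferentiableAt.comp z
      (differentiableAt_inverse (isUnit_one_sub_smul_of_norm_lt_one hT hz1))
      h.differentiableAt).differentiableWithinAt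
  exact (spectrum.hasFPowerSeriesOnBall_inverse_one_sub_smul ℂ T).exchange_radius
    (hd.hasFPowerSeriesOnBall hr0)

theorem summable_norm_pow_mul_pow {T : H →L[ℂ] H} (hT : ∀ x, ‖inner ℂ x (T x)‖ ≤ ‖x‖ ^ 2) {s : ℝ}
    (hs0 : 0 ≤ s) (hs1 : s < 1) : Summable fun n => ‖T ^ n‖ * s ^ n := by
  obtain ⟨t, hst, ht1⟩ := exists_between hs1
  lift s to NNReal using hs0
  lift t to NNReal using s.2.trans hst.le
  have h := hasFPowerSeriesOnBall_inverse_one_sub_smul_of_lt_one hT (r := t)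
    (by exact_mod_cast s.2.trans_lt hst) (by exact_mod_cast ht1)
  have := FormalMultilinearSeries.summable_norm_mul_pow _ (r := s)
    (lt_of_lt_of_le (by exact_mod_cast hst) h.r_le)
  simpa using this

theorem hasSum_inverse_one_sub_smul {T : H →L[ℂ] H} (hT : ∀ x, ‖inner ℂ x (T x)‖ ≤ ‖x‖ ^ 2) {z : ℂ}
    (hz : ‖z‖ < 1) : HasSum (fun n => z ^ n • T ^ n) (Ring.inverse (1 - z • T)) := by
  obtain ⟨t, hst, ht1⟩ := exists_between hz
  lift t to NNReal using (norm_nonneg z).trans hst.le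
  have h := hasFPowerSeriesOnBall_inverse_one_sub_smul_of_lt_one hT (r := t)
    (by exact_mod_cast (norm_nonneg z).trans_lt hst) (by exact_mod_cast ht1)
  have := h.hasSum (y := z) (by
    rw [Metric.eball_coe]; exact mem_ball_zero_iff.mpr hst)
  simpa using this

theorem hasPowerDecay_smul {T : H →L[ℂ] H} (hT : ∀ x, ‖inner ℂ x (T x)‖ ≤ ‖x‖ ^ 2) {r : ℝ}
    (hr0 : 0 ≤ r) (hr1 : r < 1) : HasPowerDecay ((r : ℂ) • T) := by
  have hs1 : √r < 1 := by rw [Real.sqrt_lt' one_pos]; simpa using hr1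
  have hsum := summable_norm_pow_mul_pow hT (Real.sqrt_nonneg r) hs1
  refine ⟨√r, ∑' n, ‖T ^ n‖ * √r ^ n, Real.sqrt_nonneg r, hs1, fun n => ?_⟩
  have h1 : ‖T ^ n‖ * √r ^ n ≤ ∑' n, ‖T ^ n‖ * √r ^ n :=
    hsum.le_tsum n fun _ _ => by positivity
  rw [smul_pow, norm_smul, norm_pow, Complex.norm_real, Real.norm_of_nonneg hr0]
  calc r ^ n * ‖T ^ n‖ = (‖T ^ n‖ * √r ^ n) * √r ^ n := by
        rw [mul_assoc, ← mul_pow, Real.mul_self_sqrt hr0, mul_comm]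
    _ ≤ _ := by gcongr

theorem le_re_inner_holoCalc {T : H →L[ℂ] H} (hT : ∀ x, ‖inner ℂ x (T x)‖ ≤ ‖x‖ ^ 2) {r : ℝ}
    (hr0 : 0 ≤ r) (hr1 : r < 1) {h : ℂ → ℂ} (hh : DifferentiableOn ℂ h (ball 0 1)) {m : ℝ}
    (hm : ∀ z ∈ ball (0 : ℂ) 1, m ≤ (h z).re) (x : H) :
    (2 * m - (h 0).re) * ‖x‖ ^ 2 ≤ (inner ℂ x (holoCalc h ((r : ℂ) • T) x)).re := by
  have hs0 := Real.sqrt_nonneg r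
  have hs1 : √r < 1 := by rw [Real.sqrt_lt' one_pos]; simpa using hr1
  set L : (H →L[ℂ] H) →L[ℂ] ℂ := (innerSL ℂ x).comp (ContinuousLinearMap.apply ℂ H x) with hL
  have hLapp : ∀ S : H →L[ℂ] H, L S = inner ℂ x (S x) := fun S => by simp [hL]
  -- Writing `rⁿ = √rⁿ · √rⁿ` gives one factor to `h` and one to the resolvent, so both series
  -- converge absolutely on the circle of radius `√r < 1`.
  have key := le_re_tsum_hadamard (a := taylorCoeff h) (c := fun n => L (T ^ n)) (m := m) hs0
    (summable_norm_taylorCoeff hh hs0 hs1) ?_ ?_ ?_ ?_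
  · have h0 : (L (T ^ 0)).re = ‖x‖ ^ 2 := by
      rw [hLapp, pow_zero, one_apply_eq_self, inner_self_eq_norm_sq_to_K]
      norm_cast
    have h1 := (summable_norm_taylorTerm hh (hasPowerDecay_smul hT hr0 hr1)).of_norm.hasSum.mapL L
    have h2 : (fun n => taylorCoeff h n * (√r : ℂ) ^ n * (L (T ^ n) * (√r : ℂ) ^ n))
        = fun n => L (taylorTerm h ((r : ℂ) • T) n) := by
      ext n
      have : (r : ℂ) ^ n = (√r : ℂ) ^ n * (√r : ℂ) ^ n := by
        rw [← mul_pow, ← Complex.ofReal_mul, Real.mul_self_sqrt hr0]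
      rw [taylorTerm_eq, smul_pow, map_smul, map_smul, smul_eq_mul, smul_eq_mul, this]
      ring
    rw [h0, taylorCoeff_zero, h2, h1.tsum_eq, hLapp] at key
    exact key
  · refine Summable.of_nonneg_of_le (fun n => by positivity) (fun n => ?_)
      ((summable_norm_pow_mul_pow hT hs0 hs1).mul_left ‖L‖)
    rw [← mul_assoc]
    gcongr
    exact L.le_opNorm _
  · rw [hLapp, pow_zero, one_apply_eq_self, inner_self_eq_norm_sq_to_K]
    norm_cast
  · intro z hz
    have hz1 : ‖z‖ < 1 := hz.trans_lt hs1
    have h1 := (hasSum_inverse_one_sub_smul hT hz1).mapL L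
    have h2 : (fun n => L (T ^ n) * z ^ n) = fun n => L (z ^ n • T ^ n) := by
      ext n; rw [map_smul, smul_eq_mul, mul_comm]
    rw [h2, h1.tsum_eq, hLapp]
    -- With `x = (1 - zT)w`, positivity of the resolvent at `x` is positivity of `1 - zT` at `w`.
    set w := Ring.inverse (1 - z • T) x with hw
    have hx : x = (1 - z • T) w := by
      rw [hw, ← mul_apply_eq_comp,
        Ring.mul_inverse_cancel _ (isUnit_one_sub_smul_of_norm_lt_one hT hz1)]
      rfl
    rw [hx, ← inner_conj_symm, Complex.conj_re]
    exact le_trans (by nlinarith [sq_nonneg ‖w‖]) (le_re_inner_one_sub_smul hT z w)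
  · intro z hz
    have hz1 : z ∈ ball (0 : ℂ) 1 := mem_ball_zero_iff.mpr (hz.trans_lt hs1)
    rw [(hasSum_taylorCoeff hh hz1).tsum_eq]
    exact hm z hz1

/-- The factor `3` comes from `2m - Re h(0) ≥ -2M - M`; any constant independent of `r` suffices for
the Cauchy argument. -/
theorem norm_inner_holoCalc_le {T : H →L[ℂ] H} (hT : ∀ x, ‖inner ℂ x (T x)‖ ≤ ‖x‖ ^ 2) {r : ℝ}
    (hr0 : 0 ≤ r) (hr1 : r < 1) {h : ℂ → ℂ} (hh : DifferentiableOn ℂ h (ball 0 1)) {M : ℝ}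
    (hM : ∀ z ∈ ball (0 : ℂ) 1, ‖h z‖ ≤ M) (x : H) :
    ‖inner ℂ x (holoCalc h ((r : ℂ) • T) x)‖ ≤ 3 * M * ‖x‖ ^ 2 := by
  obtain ⟨u, hu, hux⟩ := RCLike.exists_norm_eq_mul_self (inner ℂ x (holoCalc h ((r : ℂ) • T) x))
  have hux' : -u * inner ℂ x (holoCalc h ((r : ℂ) • T) x)
      = ((-‖inner ℂ x (holoCalc h ((r : ℂ) • T) x)‖ : ℝ) : ℂ) := by
    rw [neg_mul, ← hux, Complex.ofReal_neg]; rfl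
  have hb : ∀ z ∈ ball (0 : ℂ) 1, |((-u) * h z).re| ≤ M := fun z hz =>
    (Complex.abs_re_le_norm _).trans (by rw [norm_mul, norm_neg, hu, one_mul]; exact hM z hz)
  have key := le_re_inner_holoCalc hT hr0 hr1 (hh.const_mul (-u)) (m := -M)
    (fun z hz => neg_le_of_abs_le (hb z hz)) x
  rw [holoCalc_const_mul hh _ (hasPowerDecay_smul hT hr0 hr1), smul_apply, inner_smul_right,
    hux', Complex.ofReal_re] at key
  have h0 := le_of_abs_le (hb 0 (by simp))
  have h2 : -(3 * M) * ‖x‖ ^ 2 ≤ (2 * -M - (-u * h 0).re) * ‖x‖ ^ 2 := by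
    gcongr; linarith
  linarith [h2.trans key]

theorem norm_holoCalc_le {T : H →L[ℂ] H} (hT : ∀ x, ‖inner ℂ x (T x)‖ ≤ ‖x‖ ^ 2) {r : ℝ}
    (hr0 : 0 ≤ r) (hr1 : r < 1) {h : ℂ → ℂ} (hh : DifferentiableOn ℂ h (ball 0 1)) {M : ℝ}
    (hM0 : 0 < M) (hM : ∀ z ∈ ball (0 : ℂ) 1, ‖h z‖ ≤ M) :
    ‖holoCalc h ((r : ℂ) • T)‖ ≤ 6 * M := by
  have := opNorm_le_of_norm_inner_le (by positivity) (norm_inner_holoCalc_le hT hr0 hr1 hh hM)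
  linarith

theorem exists_tendsto_holoCalc {T : H →L[ℂ] H} (hT : ∀ x, ‖inner ℂ x (T x)‖ ≤ ‖x‖ ^ 2) {f : ℂ → ℂ}
    (hf : InDiskAlgebra f) :
    ∃ S, Tendsto (fun r : ℝ => holoCalc f ((r : ℂ) • T)) (𝓝[<] (1 : ℝ)) (𝓝 S) := by
  rw [← cauchy_map_iff_exists_tendsto, Metric.cauchy_iff]
  refine ⟨inferInstance, fun ε hε => ?_⟩
  obtain ⟨δ, hδ, huc⟩ := Metric.uniformContinuousOn_iff.mp
    ((isCompact_closedBall (0 : ℂ) 1).uniformContinuousOn_of_continuous hf.continuousOn)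
    (ε / 7) (by positivity)
  refine ⟨_, image_mem_map (Ioo_mem_nhdsLT (show max 0 (1 - δ) < 1 by simp [hδ])), ?_⟩
  rintro _ ⟨r, hr, rfl⟩ _ ⟨s, hs, rfl⟩
  rw [mem_Ioo, max_lt_iff] at hr hs
  obtain ⟨⟨hr0, hrδ⟩, hr1⟩ := hr
  obtain ⟨⟨hs0, hsδ⟩, hs1⟩ := hs
  -- A common `t` above `r` and `s` expresses `f(rT) - f(sT)` as one function `f((r/t)z) -
  -- f((s/t)z)` at `tT`. That function is at most `ε/7` on the disk, and `6 · ε/7 < ε`.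
  obtain ⟨t, hmt, ht1⟩ := exists_between (max_lt hr1 hs1)
  obtain ⟨hrt, hst⟩ := max_lt_iff.mp hmt
  have ht0 : 0 < t := hr0.trans hrt
  have hdiv : ∀ q : ℝ, 0 < q → q < t → 1 - δ < q →
      0 < q / t ∧ q / t < 1 ∧ 1 - δ < q / t := fun q h0 h1 h2 =>
    ⟨div_pos h0 ht0, (div_lt_one ht0).mpr h1, h2.trans (by rw [lt_div_iff₀ ht0]; nlinarith)⟩
  obtain ⟨hr0', hr1', hrδ'⟩ := hdiv r hr0 hrt hrδ
  obtain ⟨hs0', hs1', hsδ'⟩ := hdiv s hs0 hst hsδ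
  have hn : ∀ q : ℝ, 0 < q → q < 1 → ‖(q : ℂ)‖ ≤ 1 := fun q h0 h1 => by
    rw [Complex.norm_real, Real.norm_of_nonneg h0.le]; exact h1.le
  have hmaps : ∀ q : ℝ, 0 < q → q < 1 → ∀ z ∈ ball (0 : ℂ) 1, (q : ℂ) * z ∈ ball (0 : ℂ) 1 := by
    intro q h0 h1 z hz
    rw [mem_ball_zero_iff] at hz ⊢
    rw [norm_mul]
    exact (mul_le_of_le_one_left (norm_nonneg z) (hn q h0 h1)).trans_lt hz
  have hd : ∀ q : ℝ, 0 < q → q < 1 → DifferentiableOn ℂ (fun z => f (q * z)) (ball 0 1) :=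
    fun q h0 h1 => hf.holomorphic.comp (differentiableOn_id.const_mul (q : ℂ)) (hmaps q h0 h1)
  have hsm : ∀ q : ℝ, ((q / t : ℝ) : ℂ) • (t : ℂ) • T = (q : ℂ) • T := fun q => by
    rw [smul_smul, ← Complex.ofReal_mul, div_mul_cancel₀ _ ht0.ne']
  have hpd := hasPowerDecay_smul hT ht0.le ht1
  have heq : holoCalc (fun z => f ((r / t : ℝ) * z) + (-1) * f ((s / t : ℝ) * z)) ((t : ℂ) • T)
      = holoCalc f ((r : ℂ) • T) - holoCalc f ((s : ℂ) • T) := by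
    rw [holoCalc_add (hd _ hr0' hr1') ((hd _ hs0' hs1').const_mul _) hpd,
      holoCalc_const_mul (hd _ hs0' hs1') _ hpd,
      holoCalc_comp_mul hf.holomorphic (hn _ hr0' hr1'),
      holoCalc_comp_mul hf.holomorphic (hn _ hs0' hs1'), hsm, hsm, neg_one_smul, sub_eq_add_neg]
  rw [dist_eq_norm, ← heq]
  refine lt_of_le_of_lt (norm_holoCalc_le hT ht0.le ht1
    ((hd _ hr0' hr1').add ((hd _ hs0' hs1').const_mul _)) (M := ε / 7) (by positivity) ?_)
    (by linarith)
  intro z hz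
  have := huc _ (ball_subset_closedBall (hmaps _ hr0' hr1' z hz)) _
    (ball_subset_closedBall (hmaps _ hs0' hs1' z hz)) ?_
  · rw [dist_eq_norm] at this
    change ‖f (_ * z) + -1 * f (_ * z)‖ ≤ _
    rw [neg_one_mul, ← sub_eq_add_neg]
    exact this.le
  · rw [dist_eq_norm, ← sub_mul, norm_mul, ← Complex.ofReal_sub, Complex.norm_real,
      Real.norm_eq_abs]
    have h1 : |r / t - s / t| < δ := by rw [abs_lt]; constructor <;> linarith
    rw [mem_ball_zero_iff] at hz
    nlinarith [abs_nonneg (r / t - s / t), norm_nonneg z]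

end Calculus

/-! ### Berger–Stampfli and teardrop bounds for `f(rT)`. -/

section Teardrop

variable {H : Type*} [NormedAddCommGroup H] [InnerProductSpace ℂ H] [CompleteSpace H]

theorem one_sub_ne_zero_of_norm_lt_one {w : ℂ} (hw : ‖w‖ < 1) : 1 - w ≠ 0 := fun h => by
  rw [← sub_eq_zero.mp h, norm_one] at hw
  exact lt_irrefl _ hw

theorem half_le_re_inv_one_sub {w : ℂ} (hw : ‖w‖ < 1) : 1 / 2 ≤ ((1 - w)⁻¹).re := by
  have h0 : 0 < Complex.normSq (1 - w) :=
    Complex.normSq_pos.mpr (one_sub_ne_zero_of_norm_lt_one hw)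
  rw [Complex.inv_re, le_div_iff₀ h0]
  have h1 : ‖w‖ ^ 2 ≤ 1 := by nlinarith [norm_nonneg w]
  rw [Complex.sq_norm, Complex.normSq_apply] at h1
  simp only [Complex.normSq_apply, Complex.sub_re, Complex.sub_im, Complex.one_re, Complex.one_im]
  nlinarith

/-- The Berger–Stampfli theorem for `g(rT)`. -/
theorem norm_inner_holoCalc_le_of_map_zero {T : H →L[ℂ] H}
    (hT : ∀ x, ‖inner ℂ x (T x)‖ ≤ ‖x‖ ^ 2) {r : ℝ} (hr0 : 0 ≤ r) (hr1 : r < 1) {g : ℂ → ℂ}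
    (hg : DifferentiableOn ℂ g (ball 0 1)) (hg0 : g 0 = 0)
    (hg1 : ∀ z ∈ ball (0 : ℂ) 1, ‖g z‖ < 1) (y : H) :
    ‖inner ℂ y (holoCalc g ((r : ℂ) • T) y)‖ ≤ ‖y‖ ^ 2 := by
  have hpd := hasPowerDecay_smul hT hr0 hr1
  set A := holoCalc g ((r : ℂ) • T) with hA
  obtain ⟨u, hu, huy⟩ := RCLike.exists_norm_eq_mul_self (inner ℂ y (A y))
  have hug : ∀ z ∈ ball (0 : ℂ) 1, ‖u * g z‖ < 1 := fun z hz => by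
    rw [norm_mul, hu, one_mul]; exact hg1 z hz
  have hd : DifferentiableOn ℂ (fun z => 1 + (-u) * g z) (ball 0 1) :=
    (hg.const_mul _).const_add 1
  have hsub : ∀ z, 1 + (-u) * g z = 1 - u * g z := fun z => by ring
  have hne : ∀ z ∈ ball (0 : ℂ) 1, 1 + (-u) * g z ≠ 0 := fun z hz => by
    rw [hsub]; exact one_sub_ne_zero_of_norm_lt_one (hug z hz)
  have hh : DifferentiableOn ℂ (fun z => (1 + (-u) * g z)⁻¹) (ball 0 1) := hd.inv hne
  have hmul : holoCalc (fun z => (1 + (-u) * g z)⁻¹) ((r : ℂ) • T) * (1 + (-u) • A) = 1 := by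
    have h1 : (1 : H →L[ℂ] H) + (-u) • A = holoCalc (fun z => 1 + (-u) * g z) ((r : ℂ) • T) := by
      rw [holoCalc_add (differentiableOn_const 1) (hg.const_mul _) hpd, holoCalc_const,
        holoCalc_const_mul hg _ hpd, one_smul]
    rw [h1, ← holoCalc_mul hh hd hpd, holoCalc_congr
      (f := fun z => (1 + (-u) * g z)⁻¹ * (1 + (-u) * g z)) (hh.mul hd) (differentiableOn_const 1)
      (fun z hz => inv_mul_cancel₀ (hne z hz)), holoCalc_const, one_smul]
  -- The function `1/(1 - ug)` equals `1` at `0`, so with `m = 1/2` the lower bound vanishes. The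
  -- test vector `(1 - uA)y` turns the inequality into `Re ⟨y, (1 - uA)y⟩ ≥ 0`.
  have key := le_re_inner_holoCalc hT hr0 hr1 hh (m := 1 / 2)
    (fun z hz => by rw [hsub]; exact half_le_re_inv_one_sub (hug z hz)) ((1 + (-u) • A) y)
  rw [← mul_apply_eq_comp, hmul, hg0] at key
  have h2 : inner ℂ y ((1 + (-u) • A) y) = ((‖y‖ ^ 2 - ‖inner ℂ y (A y)‖ : ℝ) : ℂ) := by
    have h3 : inner ℂ y ((1 + (-u) • A) y) = inner ℂ y y - u * inner ℂ y (A y) := by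
      simp [inner_smul_right, sub_eq_add_neg]
    rw [h3, ← huy, inner_self_eq_norm_sq_to_K]
    push_cast
    rfl
  rw [one_apply_eq_self, ← inner_conj_symm, h2, Complex.conj_ofReal,
    Complex.ofReal_re] at key
  norm_num at key
  exact key

theorem norm_sub_lt_norm_one_sub_conj_mul {α w : ℂ} (hα : ‖α‖ < 1) (hw : ‖w‖ < 1) :
    ‖w - α‖ < ‖1 - starRingEnd ℂ α * w‖ := by
  refine lt_of_pow_lt_pow_left₀ 2 (norm_nonneg _) ?_
  have h1 : 0 < (1 - ‖α‖ ^ 2) * (1 - ‖w‖ ^ 2) :=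
    mul_pos (by nlinarith [norm_nonneg α]) (by nlinarith [norm_nonneg w])
  have h2 : ‖1 - starRingEnd ℂ α * w‖ ^ 2 - ‖w - α‖ ^ 2 = (1 - ‖α‖ ^ 2) * (1 - ‖w‖ ^ 2) := by
    simp only [Complex.sq_norm, Complex.normSq_apply, Complex.sub_re, Complex.sub_im,
      Complex.mul_re, Complex.mul_im, Complex.conj_re, Complex.conj_im, Complex.one_re,
      Complex.one_im]
    ring
  linarith

/-- The numerical radius bound of Drury's teardrop theorem for `F(rT)`, when `F` maps the open
disk to itself. -/
theorem norm_inner_holoCalc_le_of_mapsTo_ball {T : H →L[ℂ] H}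
    (hT : ∀ x, ‖inner ℂ x (T x)‖ ≤ ‖x‖ ^ 2) {r : ℝ} (hr0 : 0 ≤ r) (hr1 : r < 1) {F : ℂ → ℂ}
    (hF : DifferentiableOn ℂ F (ball 0 1)) (hF1 : ∀ z ∈ ball (0 : ℂ) 1, ‖F z‖ < 1) (x : H) :
    ‖inner ℂ x (holoCalc F ((r : ℂ) • T) x)‖ ≤ (1 + ‖F 0‖ - ‖F 0‖ ^ 2) * ‖x‖ ^ 2 := by
  have hpd := hasPowerDecay_smul hT hr0 hr1
  set S := holoCalc F ((r : ℂ) • T) with hS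
  set α := F 0 with hα
  have hα1 : ‖α‖ < 1 := hF1 0 (by simp)
  set β := starRingEnd ℂ α with hβ
  have hlt : ∀ z ∈ ball (0 : ℂ) 1, ‖F z - α‖ < ‖1 - β * F z‖ := fun z hz =>
    norm_sub_lt_norm_one_sub_conj_mul hα1 (hF1 z hz)
  have hsub : ∀ z, 1 + (-β) * F z = 1 - β * F z := fun z => by ring
  have hne : ∀ z ∈ ball (0 : ℂ) 1, 1 + (-β) * F z ≠ 0 := fun z hz => by
    rw [hsub, ← norm_pos_iff]; exact (norm_nonneg _).trans_lt (hlt z hz)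
  have hd : DifferentiableOn ℂ (fun z => 1 + (-β) * F z) (ball 0 1) :=
    (hF.const_mul _).const_add 1
  have hd' : DifferentiableOn ℂ (fun z => F z + -α) (ball 0 1) := hF.add_const _
  have hg : DifferentiableOn ℂ (fun z => (F z + -α) / (1 + (-β) * F z)) (ball 0 1) :=
    hd'.div hd hne
  set A := holoCalc (fun z => (F z + -α) / (1 + (-β) * F z)) ((r : ℂ) • T) with hA
  have hAw : ∀ y, ‖inner ℂ y (A y)‖ ≤ ‖y‖ ^ 2 :=
    norm_inner_holoCalc_le_of_map_zero hT hr0 hr1 hg (by simp [← hα]) fun z hz => by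
      rw [norm_div, hsub, ← sub_eq_add_neg,
        div_lt_one ((norm_nonneg _).trans_lt (hlt z hz))]
      exact hlt z hz
  have hmul : A * (1 + (-β) • S) = S + (-α) • 1 := by
    have h1 : (1 : H →L[ℂ] H) + (-β) • S = holoCalc (fun z => 1 + (-β) * F z) ((r : ℂ) • T) := by
      rw [holoCalc_add (differentiableOn_const 1) (hF.const_mul _) hpd, holoCalc_const,
        holoCalc_const_mul hF _ hpd, one_smul]
    rw [h1, hA, ← holoCalc_mul hg hd hpd, holoCalc_congr
      (f := fun z => (F z + -α) / (1 + (-β) * F z) * (1 + (-β) * F z)) (hg.mul hd) hd'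
      (fun z hz => div_mul_cancel₀ _ (hne z hz)),
      holoCalc_add hF (differentiableOn_const _) hpd, holoCalc_const]
  -- Up to the factor `1 - |α|²`, this is `(1 + ᾱA)⁻¹x`; defining it through `S` avoids inverting `1
  -- + ᾱA`.
  set y := x - β • S x with hy
  have hAy : A y = S x - α • x := by
    have := congrArg (fun B : H →L[ℂ] H => B x) hmul
    simpa [hy, sub_eq_add_neg] using this
  have hβα : β * α = ((‖α‖ ^ 2 : ℝ) : ℂ) := by
    rw [hβ, mul_comm, Complex.mul_conj, Complex.normSq_eq_norm_sq]
  have h1 : y + β • A y = ((1 - ‖α‖ ^ 2 : ℝ) : ℂ) • x := by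
    rw [hAy, hy, Complex.ofReal_sub, ← hβα, Complex.ofReal_one]; module
  have h2 : α • y + A y = ((1 - ‖α‖ ^ 2 : ℝ) : ℂ) • S x := by
    rw [hAy, hy, Complex.ofReal_sub, ← hβα, Complex.ofReal_one]; module
  have key := norm_inner_mobius_le hAw hα1.le y
  have hk : 0 < 1 - ‖α‖ ^ 2 := by nlinarith [norm_nonneg α]
  rw [← hβ, h1, h2, inner_smul_left, inner_smul_right, norm_smul, Complex.conj_ofReal, norm_mul,
    norm_mul, Complex.norm_real, Real.norm_of_nonneg hk.le] at key
  refine le_of_mul_le_mul_left ?_ (mul_pos hk hk)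
  linarith

/-- Multiplying `f` by `s < 1` makes the disk bound strict, including for unimodular constants; then
`s → 1`. -/
theorem norm_inner_holoCalc_le_of_mapsTo_closedBall {T : H →L[ℂ] H}
    (hT : ∀ x, ‖inner ℂ x (T x)‖ ≤ ‖x‖ ^ 2) {r : ℝ} (hr0 : 0 ≤ r) (hr1 : r < 1) {f : ℂ → ℂ}
    (hf : DifferentiableOn ℂ f (ball 0 1)) (hf1 : ∀ z ∈ ball (0 : ℂ) 1, ‖f z‖ ≤ 1) (x : H) :
    ‖inner ℂ x (holoCalc f ((r : ℂ) • T) x)‖ ≤ (1 + ‖f 0‖ - ‖f 0‖ ^ 2) * ‖x‖ ^ 2 := by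
  have key : ∀ s ∈ Ioo (0 : ℝ) 1, s * ‖inner ℂ x (holoCalc f ((r : ℂ) • T) x)‖
      ≤ (1 + s * ‖f 0‖ - (s * ‖f 0‖) ^ 2) * ‖x‖ ^ 2 := by
    intro s hs
    have h := norm_inner_holoCalc_le_of_mapsTo_ball hT hr0 hr1 (hf.const_mul (s : ℂ))
      (fun z hz => by
        rw [norm_mul, Complex.norm_real, Real.norm_of_nonneg hs.1.le]
        exact (mul_le_of_le_one_right hs.1.le (hf1 z hz)).trans_lt hs.2) x
    rwa [holoCalc_const_mul hf _ (hasPowerDecay_smul hT hr0 hr1), smul_apply, inner_smul_right,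
      norm_mul, norm_mul, Complex.norm_real, Real.norm_of_nonneg hs.1.le] at h
  have hl : Tendsto (fun s : ℝ => s * ‖inner ℂ x (holoCalc f ((r : ℂ) • T) x)‖) (𝓝[<] 1)
      (𝓝 (1 * ‖inner ℂ x (holoCalc f ((r : ℂ) • T) x)‖)) :=
    (Continuous.tendsto (by fun_prop) 1).mono_left nhdsWithin_le_nhds
  have hR : Tendsto (fun s : ℝ => (1 + s * ‖f 0‖ - (s * ‖f 0‖) ^ 2) * ‖x‖ ^ 2) (𝓝[<] 1)
      (𝓝 ((1 + 1 * ‖f 0‖ - (1 * ‖f 0‖) ^ 2) * ‖x‖ ^ 2)) :=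
    (Continuous.tendsto (by fun_prop) 1).mono_left nhdsWithin_le_nhds
  have := le_of_tendsto_of_tendsto hl hR
    (Filter.eventually_of_mem (Ioo_mem_nhdsLT one_pos) key)
  simpa only [one_mul] using this

end Teardrop

/-! ### The main theorem. -/

theorem corollary4p2 {H : Type*} [NormedAddCommGroup H] [InnerProductSpace ℂ H] [CompleteSpace H]
    (T : H →L[ℂ] H) (hT : numericalRange T ⊆ Metric.closedBall (0 : ℂ) 1)
    (f : ℂ → ℂ) (hf : InDiskAlgebra f)
    (hmaps : Set.MapsTo f (Metric.closedBall (0 : ℂ) 1) (Metric.closedBall (0 : ℂ) 1)) :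
    IsDiskCalc f T (diskCalc f T) ∧
      numericalRadius (diskCalc f T) ≤ 1 + ‖f 0‖ - ‖f 0‖ ^ 2 ∧
      1 + ‖f 0‖ - ‖f 0‖ ^ 2 ≤ 5 / 4 := by
  have hT' : ∀ x, ‖inner ℂ x (T x)‖ ≤ ‖x‖ ^ 2 := fun x => by
    have := norm_inner_le_of_forall_unit (M := 1)
      (fun x hx => mem_closedBall_zero_iff.mp (hT ⟨x, hx, rfl⟩)) x
    rwa [one_mul] at this
  have hf1 : ∀ z ∈ closedBall (0 : ℂ) 1, ‖f z‖ ≤ 1 := fun z hz =>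
    mem_closedBall_zero_iff.mp (hmaps hz)
  have h0 : ‖f 0‖ ≤ 1 := hf1 0 (by simp)
  have hlim : Tendsto (fun r : ℝ => holoCalc f ((r : ℂ) • T)) (𝓝[<] (1 : ℝ)) (𝓝 (diskCalc f T)) :=
    tendsto_nhds_limUnder (exists_tendsto_holoCalc hT' hf)
  refine ⟨⟨fun r hr0 hr1 => (summable_norm_taylorTerm hf.holomorphic
    (hasPowerDecay_smul hT' hr0.le hr1)).of_norm, hlim⟩, ?_, ?_⟩
  -- Nonnegativity of the bound is needed for `H = {0}`, where the supremum of the empty set is `0`.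
  · refine Real.sSup_le ?_ (by nlinarith [norm_nonneg (f 0)])
    rintro _ ⟨_, ⟨x, hx, rfl⟩, rfl⟩
    have hl : Tendsto (fun r : ℝ => ‖inner ℂ x (holoCalc f ((r : ℂ) • T) x)‖) (𝓝[<] 1)
        (𝓝 ‖inner ℂ x (diskCalc f T x)‖) :=
      (tendsto_const_nhds.inner
        (((ContinuousLinearMap.apply ℂ H x).continuous.tendsto _).comp hlim)).norm
    refine le_of_tendsto hl (Filter.eventually_of_mem (Ioo_mem_nhdsLT one_pos) fun r hr => ?_)
    simpa [hx] using norm_inner_holoCalc_le_of_mapsTo_closedBall hT' hr.1.le hr.2 hf.holomorphic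
      (fun z hz => hf1 z (ball_subset_closedBall hz)) x
  · nlinarith [sq_nonneg (‖f 0‖ - 1 / 2)]
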